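/- Let $r > s \ge 1$ be integers. For an $r$-graph $G$ on $[n]$ (a family of $r$-subsets of $[n]$), let $M_s^r(G)$ be the $\{0,1\}$-matrix with rows indexed by the edges of $G$ and columns indexed by the $s$-subsets of $[n]$, whose entry at $(e,S)$ is $1$ if and only if $S\subseteq e$; ranks are over $\mathbb{R}$ (and an empty matrix has rank $0$). Let $\mathrm{rex}(n,t,r,s)$ be the maximum number of edges of an $r$-graph $G$ on $[n]$ with $\mathrm{rk}\, M_s^r(G)\le \binom ns - t$; an $r$-graph attaining this maximum is called rank-extremal. An $s$-star configuration is a collection of $s$-subsets of $[n]$ whose common intersection has size at least $s-1$. The upper $(r-s)$-shadow of a collection of $s$-sets is the family of all $r$-subsets of $[n]$ containing at least one of them. Then there are a real constant $c_0>0$ and a positive integer $n_0$, depending only on $r$ and $s$, such that for all integers $n\ge n_0$ and $1\le t\le c_0 n$, $$\mathrm{rex}(n,t,r,s)=\binom nr-\binom{n-s+1}{r-s+1}+\binom{n-s+1-t}{r-s+1}.$$ Furthermore, $s$-star configurations of size $t$ on $[n]$ exist, and, up to isomorphism, the unique rank-extremal $r$-graph is the complete $r$-graph $K_n^r$ minus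 the upper $(r-s)$-shadow of an $s$-star configuration of size $t$: for every such configuration $\mathcal S$, an $r$-graph on $[n]$ is rank-extremal if and only if it is isomorphic to $K_n^r$ minus the upper $(r-s)$-shadow of $\mathcal S$. -/

import Mathlib

namespace RankExtremal

/-- An `r`-graph on the vertex set `V`, given by its edge set: every edge has size `r`. -/
def IsRGraph {V : Type*} (r : ℕ) (G : Finset (Finset V)) : Prop :=
  ∀ e ∈ G, e.card = r

/-- The higher inclusion matrix `M_s^r(G)`: rows are indexed by the edges of `G`, columns by the
`s`-subsets of `V`; the entry at `(e, S)` is `1` if `S ⊆ e` and `0` otherwise. -/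
def inclusionMatrix {V : Type*} [DecidableEq V] (s : ℕ) (G : Finset (Finset V)) :
    Matrix {e : Finset V // e ∈ G} {S : Finset V // S.card = s} ℝ :=
  Matrix.of fun e S => if S.1 ⊆ e.1 then 1 else 0

/-- The rank over `ℝ` of the higher inclusion matrix. -/
noncomputable def inclusionRank {V : Type*} [Fintype V] [DecidableEq V] (s : ℕ)
    (G : Finset (Finset V)) : ℕ :=
  (inclusionMatrix s G).rank

/-- `G` is an `r`-graph on `[n]` with `rk M_s^r(G) ≤ C(n,s) - t`. -/
def IsRankBounded (n t r s : ℕ) (G : Finset (Finset (Fin n))) : Prop :=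
  IsRGraph r G ∧ (inclusionRank s G : ℤ) ≤ (n.choose s : ℤ) - (t : ℤ)

/-- The rank-extremal function: the maximum number of edges of an `r`-graph `G` on `[n]` with
`rk M_s^r(G) ≤ C(n,s) - t`. -/
noncomputable def rex (n t r s : ℕ) : ℕ :=
  sSup {m : ℕ | ∃ G : Finset (Finset (Fin n)), IsRankBounded n t r s G ∧ G.card = m}

/-- `G` is rank-extremal: it attains the maximum in the definition of `rex`. -/
def IsRankExtremal (n t r s : ℕ) (G : Finset (Finset (Fin n))) : Prop :=
  IsRankBounded n t r s G ∧ G.card = rex n t r s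

/-- An `s`-star configuration: a collection of `s`-sets whose common intersection has size at
least `s - 1`. -/
def IsStarConfiguration {V : Type*} [Fintype V] [DecidableEq V] (s : ℕ)
    (S : Finset (Finset V)) : Prop :=
  (∀ A ∈ S, A.card = s) ∧ s - 1 ≤ (Finset.univ.filter fun v : V => ∀ A ∈ S, v ∈ A).card

/-- The complete `r`-graph on `V` minus the upper `(r-s)`-shadow of a collection of `s`-sets. -/
def completeMinusUpShadow {V : Type*} [Fintype V] [DecidableEq V] (r s : ℕ)
    (S : Finset (Finset V)) : Finset (Finset V) :=
  Finset.powersetCard r Finset.univ \ Finset.upShadow^[r - s] S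

/-- Isomorphism of hypergraphs on the same vertex set. -/
def IsIsomorphic {V : Type*} [DecidableEq V] (G H : Finset (Finset V)) : Prop :=
  ∃ σ : Equiv.Perm V, G.image (fun e => e.image σ) = H

end RankExtremal

namespace RankExtremal

open Finset

variable {V : Type*} [DecidableEq V]

/-! Pass to the missing edges: let H be the complement of G. The rank condition says that the kernel
of the inclusion matrix (functions on s-sets whose sum over the s-subsets of every edge of G is 0)
has dimension at least t. Let F be the union of the supports of the kernel. Suppose H is no larger
than the shadow of a t-star, so |H| ≤ t n^(r-s); the aim is that |F| = t and H is exactly the upper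
shadow of F.

Every S in F lies in at least c n^(r-s) members of H. Indeed the inclusion matrix of an (r+s)-set is
injective (`eq_zero_of_sum_powersetCard_eq_zero`), so for each r-set T disjoint from S some r-subset
of S ∪ T is in H, and for t ≤ c₀ n the members of H not containing S serve only few T. Double
counting gives |F| = O(t) (`card_support_le`).

Put k = |F| - t. A shadow set outside H gives a 0/1 vector orthogonal to the kernel. These vectors
span dimension at most k, so they involve O(k) members of F; each such set contains two of them, so
there are O(k² n^(r-s-1)) such sets (`card_upFamily_sdiff_le`). But the shadow of F exceeds that of
a t-star by order k n^(r-s) (`sum_choose_le_card_upFamily`). Hence k > 0 would give n = O(k) = O(t),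
which c₀ excludes. For k = 0 the shadow lies in H, sizes agree, and equality in the shadow bound
forces a star (`isStarConfiguration_of_card_upFamily_le`). -/

/-! ### Injectivity of inclusion matrices -/

/-- A function on sets of equal size that is invariant under exchanging one element is constant. -/
theorem eq_of_exchange_invariant (X : Finset V) (s : ℕ) (f : Finset V → ℝ)
    (h : ∀ A ⊆ X, A.card + 1 = s → ∀ x ∈ X, ∀ y ∈ X, x ∉ A → y ∉ A →
      f (insert x A) = f (insert y A)) (k : ℕ) :
    ∀ S T : Finset V, S ⊆ X → T ⊆ X → S.card = s → T.card = s → (S \ T).card = k →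
      f S = f T := by
  induction k with
  | zero =>
    intro S T _ _ hS hT hk
    have : S ⊆ T := by simpa [sdiff_eq_empty_iff_subset] using hk
    rw [eq_of_subset_of_card_le this (by omega)]
  | succ k ih =>
    intro S T hSX hTX hS hT hk
    obtain ⟨x, hx⟩ : (S \ T).Nonempty := card_pos.1 (by omega)
    have hTS : (T \ S).card = k + 1 := by
      have h1 := card_sdiff_add_card_inter S T
      have h2 := card_sdiff_add_card_inter T S
      rw [inter_comm] at h2
      omega
    obtain ⟨y, hy⟩ : (T \ S).Nonempty := card_pos.1 (by omega)
    simp only [mem_sdiff] at hx hy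
    have h1 : f S = f (insert y (S.erase x)) := by
      have := h (S.erase x) ((erase_subset _ _).trans hSX)
        (by rw [card_erase_of_mem hx.1]; have := card_pos.2 ⟨x, hx.1⟩; omega)
        x (hSX hx.1) y (hTX hy.1) (by simp) (by simp [hy.2])
      rwa [insert_erase hx.1] at this
    rw [h1]
    apply ih _ _ _ hTX _ hT
    · have : insert y (S.erase x) \ T = (S \ T).erase x := by
        ext z
        simp only [mem_sdiff, mem_insert, mem_erase]
        constructor
        · rintro ⟨rfl | h, h'⟩
          · exact absurd hy.1 h'
          · exact ⟨h.1, h.2, h'⟩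
        · rintro ⟨a, b, c⟩
          exact ⟨Or.inr ⟨a, b⟩, c⟩
      rw [this, card_erase_of_mem (by simp [hx]), hk]
      rfl
    · exact insert_subset (hTX hy.1) ((erase_subset _ _).trans hSX)
    · rw [card_insert_of_notMem (by simp [hy.2]), card_erase_of_mem hx.1]
      have := card_pos.2 ⟨x, hx.1⟩
      omega

/-- The `s`-to-`r` inclusion matrix of a set with at least `r + s` elements is injective. -/
theorem eq_zero_of_sum_powersetCard_eq_zero (s : ℕ) :
    ∀ (r : ℕ) (X : Finset V) (f : Finset V → ℝ), s ≤ r → r + s ≤ X.card →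
      (∀ e ∈ powersetCard r X, ∑ S ∈ powersetCard s e, f S = 0) →
      ∀ S ∈ powersetCard s X, f S = 0 := by
  induction s with
  | zero =>
    intro r X f _ hX h S hS
    obtain ⟨e, he⟩ := powersetCard_nonempty.2 (show r ≤ X.card by omega)
    have := h e he
    simp at this hS
    rwa [hS]
  | succ s ih =>
    intro r X f hsr hX h S hS
    obtain ⟨r, rfl⟩ : ∃ r', r = r' + 1 := ⟨r - 1, by omega⟩
    -- The difference `f (insert x A) - f (insert y A)` satisfies the hypothesis on X without x and
    -- y, with both set sizes lowered by one, so it vanishes by induction. Then f is constant and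
    -- its sum over e is a positive multiple of its value.
    have key : ∀ A ⊆ X, A.card + 1 = s + 1 → ∀ x ∈ X, ∀ y ∈ X, x ∉ A → y ∉ A →
        f (insert x A) = f (insert y A) := by
      intro A hA hAc x hx y hy hxA hyA
      rcases eq_or_ne x y with rfl | hxy
      · rfl
      have hcard : ((X.erase x).erase y).card = X.card - 2 := by
        rw [card_erase_of_mem (by simp [hxy.symm, hy]), card_erase_of_mem hx]
        omega
      have := ih r ((X.erase x).erase y) (fun A => f (insert x A) - f (insert y A)) (by omega)
        (by omega) ?_ A ?_
      · simpa [sub_eq_zero] using this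
      · intro e he
        rw [mem_powersetCard] at he
        have hxe : x ∉ e := fun hh => by simpa using he.1 hh
        have hye : y ∉ e := fun hh => by simpa using he.1 hh
        have heX : e ⊆ X := he.1.trans ((erase_subset _ _).trans (erase_subset _ _))
        have step : ∀ z ∈ X, z ∉ e → ∑ S ∈ powersetCard (s + 1) e, f S +
            ∑ A ∈ powersetCard s e, f (insert z A) = 0 := by
          intro z hz hze
          rw [← h (insert z e) (by
            rw [mem_powersetCard]
            exact ⟨insert_subset hz heX, by rw [card_insert_of_notMem hze, he.2]⟩),
            powersetCard_succ_insert hze, sum_union, sum_image]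
          · intro a ha b hb hab
            simp only [mem_coe, mem_powersetCard] at ha hb
            rw [← erase_insert (fun hh => hze (ha.1 hh)), hab,
              erase_insert (fun hh => hze (hb.1 hh))]
          · rw [disjoint_left]
            intro a ha hb
            simp only [mem_image, mem_powersetCard] at ha hb
            obtain ⟨b, _, rfl⟩ := hb
            exact hze (ha.1 (mem_insert_self _ _))
        rw [sum_sub_distrib]
        linarith [step x hx hxe, step y hy hye]
      · rw [mem_powersetCard]
        refine ⟨fun a ha => ?_, by omega⟩
        simp only [mem_erase]
        exact ⟨fun hh => hyA (hh ▸ ha), fun hh => hxA (hh ▸ ha), hA ha⟩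
    rw [mem_powersetCard] at hS
    obtain ⟨e, he⟩ := powersetCard_nonempty.2 (show r + 1 ≤ X.card by omega)
    have h0 := h e he
    rw [mem_powersetCard] at he
    rw [sum_congr rfl (g := fun _ => f S), sum_const, card_powersetCard, smul_eq_zero] at h0
    · rcases h0 with h0 | h0
      · rw [Nat.choose_eq_zero_iff] at h0
        omega
      · exact h0
    · intro T hT
      rw [mem_powersetCard] at hT
      exact eq_of_exchange_invariant X (s + 1) f key _ T S (hT.1.trans he.1) hS.1 hT.2 hS.2 rfl

/-! ### Orthogonality and supports -/

/-- If few `0/1` vectors with small support are orthogonal to a large subspace, then their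
supports cover few coordinates. -/
theorem card_biUnion_le_of_orthogonal {ι : Type*} [Fintype ι] [DecidableEq ι]
    (W : Submodule ℝ (ι → ℝ)) (k R : ℕ) (hk : Fintype.card ι ≤ Module.finrank ℝ W + k)
    (L : Finset (Finset ι)) (hR : ∀ A ∈ L, A.card ≤ R)
    (hW : ∀ A ∈ L, ∀ w ∈ W, ∑ i ∈ A, w i = 0) :
    (L.biUnion id).card ≤ k * R := by
  classical
  let v : Finset ι → ι → ℝ := fun A i => if i ∈ A then 1 else 0
  obtain ⟨b, hbL, hspan, hli⟩ := exists_linearIndependent ℝ (v '' (L : Set (Finset ι)))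
  have hbfin : b.Finite := (L.finite_toSet.image v).subset hbL
  -- A real vector in both spaces is orthogonal to itself, hence zero; so the span has dimension at
  -- most k.
  have hdisj : Disjoint (Submodule.span ℝ b) W := by
    rw [Submodule.disjoint_def]
    intro x hx hxW
    have hort : ∀ y ∈ Submodule.span ℝ b, ∑ i, y i * x i = 0 := by
      intro y hy
      induction hy using Submodule.span_induction with
      | mem y hy =>
        obtain ⟨A, hA, rfl⟩ := hbL hy
        simpa [v] using hW A hA x hxW
      | zero => simp
      | add y z _ _ h1 h2 => simp [add_mul, sum_add_distrib, h1, h2]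
      | smul c y _ h1 => simp [mul_assoc, ← mul_sum, h1]
    have h0 := hort x hx
    rw [sum_eq_zero_iff_of_nonneg (fun i _ => mul_self_nonneg _)] at h0
    ext i
    simpa using h0 i (mem_univ i)
  have hdim := Submodule.finrank_add_finrank_le_of_disjoint hdisj
  have := hbfin.fintype
  have hbcard : hbfin.toFinset.card ≤ k := by
    rw [Module.finrank_fintype_fun_eq_card, finrank_span_set_eq_card hli] at hdim
    have : hbfin.toFinset = b.toFinset := by ext; simp
    rw [this]
    omega
  let supp : (ι → ℝ) → Finset ι := fun x => univ.filter fun i => x i ≠ 0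
  have hsupp : ∀ A, supp (v A) = A := by
    intro A
    ext i
    simp [supp, v]
  -- A coordinate outside all supports of b vanishes on the span of b, which contains every `v A`.
  have hsub : L.biUnion id ⊆ hbfin.toFinset.biUnion supp := by
    intro i hi
    simp only [mem_biUnion, id] at hi
    obtain ⟨A, hA, hi⟩ := hi
    by_contra hcon
    have hzero : ∀ y ∈ Submodule.span ℝ b, y i = 0 := by
      intro y hy
      induction hy using Submodule.span_induction with
      | mem y hy =>
        by_contra hy0
        exact hcon (mem_biUnion.2 ⟨y, by simpa using hy, by simp [supp, hy0]⟩)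
      | zero => simp
      | add y z _ _ h1 h2 => simp [h1, h2]
      | smul c y _ h1 => simp [h1]
    have := hzero (v A) (by rw [hspan]; exact Submodule.subset_span ⟨A, hA, rfl⟩)
    simp [v, hi] at this
  calc (L.biUnion id).card ≤ (hbfin.toFinset.biUnion supp).card := card_le_card hsub
    _ ≤ hbfin.toFinset.card * R := by
        apply card_biUnion_le_card_mul
        intro x hx
        obtain ⟨A, hA, rfl⟩ := hbL (by simpa using hx)
        rw [hsupp]
        exact hR A hA
    _ ≤ k * R := Nat.mul_le_mul_right _ hbcard

/-! ### Upper shadows: lower bound and equality case -/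

theorem disjoint_image_of_mem_sdiff {S : Finset V} {F : Finset (Finset V)} {c : Finset V → V}
    (hc : ∀ T ∈ F, c T ∈ T \ S) : Disjoint S (F.image c) := by
  rw [disjoint_right]
  intro x hx
  obtain ⟨T, hT, rfl⟩ := mem_image.1 hx
  exact (mem_sdiff.1 (hc T hT)).2

theorem exists_choice_mem_sdiff {s : ℕ} (hs : 1 ≤ s) {S : Finset V} {F : Finset (Finset V)}
    (hF : ∀ T ∈ F, T.card = s) (hS : S.card = s) (hSF : S ∉ F) :
    ∃ c : Finset V → V, ∀ T ∈ F, c T ∈ T \ S := by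
  have : ∀ T : Finset V, ∃ x : V, T ∈ F → x ∈ T \ S := by
    intro T
    by_cases hT : T ∈ F
    · have : (T \ S).Nonempty := by
        rw [sdiff_nonempty]
        intro h
        have := eq_of_subset_of_card_le h (by rw [hF T hT, hS])
        exact hSF (this ▸ hT)
      obtain ⟨x, hx⟩ := this
      exact ⟨x, fun _ => hx⟩
    · obtain ⟨x, -⟩ := card_pos.1 (show 0 < S.card by omega)
      exact ⟨x, fun h => absurd h hT⟩
  choose c hc using this
  exact ⟨c, hc⟩

variable [Fintype V]

/-- The `r`-sets containing at least one member of `F`. -/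
def upFamily (r : ℕ) (F : Finset (Finset V)) : Finset (Finset V) :=
  (powersetCard r univ).filter fun e => ∃ S ∈ F, S ⊆ e

/-- The `r`-sets containing `S` and disjoint from `P`. -/
def avoiding (r : ℕ) (S P : Finset V) : Finset (Finset V) :=
  (powersetCard r univ).filter fun e => S ⊆ e ∧ Disjoint e P

theorem mem_upFamily {r : ℕ} {F : Finset (Finset V)} {e : Finset V} :
    e ∈ upFamily r F ↔ e.card = r ∧ ∃ S ∈ F, S ⊆ e := by
  simp [upFamily, mem_powersetCard]

theorem mem_avoiding {r : ℕ} {S P e : Finset V} :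
    e ∈ avoiding r S P ↔ e.card = r ∧ S ⊆ e ∧ Disjoint e P := by
  simp [avoiding, mem_powersetCard]

theorem card_avoiding {r : ℕ} {S P : Finset V} (hSP : Disjoint S P) (hr : S.card ≤ r) :
    (avoiding r S P).card = (Fintype.card V - S.card - P.card).choose (r - S.card) := by
  have : avoiding r S P = (powersetCard (r - S.card) (univ \ (S ∪ P))).image (fun B => S ∪ B) := by
    ext e
    simp only [mem_avoiding, mem_image, mem_powersetCard]
    constructor
    · rintro ⟨h1, h2, h3⟩
      refine ⟨e \ S, ⟨?_, ?_⟩, union_sdiff_of_subset h2⟩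
      · intro x hx
        simp only [mem_sdiff, mem_univ, mem_union, true_and] at hx ⊢
        rintro (h | h)
        · exact hx.2 h
        · exact disjoint_left.1 h3 hx.1 h
      · rw [card_sdiff_of_subset h2, h1]
    · rintro ⟨B, ⟨h1, h2⟩, rfl⟩
      have hSB : Disjoint S B := disjoint_left.2 fun x hx hB => by
        have := h1 hB
        simp [hx] at this
      refine ⟨by rw [card_union_of_disjoint hSB]; omega, subset_union_left, ?_⟩
      rw [disjoint_union_left]
      refine ⟨hSP, disjoint_left.2 fun x hx hP => ?_⟩
      have := h1 hx
      simp [hP] at this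
  rw [this, card_image_of_injOn, card_powersetCard, card_sdiff_of_subset (subset_univ _),
    card_union_of_disjoint hSP, card_univ, Nat.sub_sub]
  intro B hB C hC hBC
  simp only [mem_coe, mem_powersetCard] at hB hC
  have h : ∀ D ⊆ univ \ (S ∪ P), (S ∪ D) \ S = D := by
    intro D hD
    rw [union_sdiff_left, Finset.sdiff_eq_self_iff_disjoint]
    refine disjoint_left.2 fun x hx hS => ?_
    have := hD hx
    simp [hS] at this
  rw [← h B hB.1, ← h C hC.1]
  exact congrArg (· \ S) hBC

/-- A set missing a chosen point of every T ∈ F contains no T; this supplies the shadow sets gained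
when S is added. -/
theorem avoiding_subset {r : ℕ} {S : Finset V} {F : Finset (Finset V)} {c : Finset V → V}
    (hc : ∀ T ∈ F, c T ∈ T \ S) :
    avoiding r S (F.image c) ⊆ upFamily r (insert S F) \ upFamily r F := by
  intro e he
  rw [mem_avoiding] at he
  simp only [mem_sdiff, mem_upFamily]
  refine ⟨⟨he.1, S, mem_insert_self _ _, he.2.1⟩, ?_⟩
  rintro ⟨-, T, hT, hTe⟩
  exact disjoint_left.1 he.2.2 (hTe (mem_sdiff.1 (hc T hT)).1) (mem_image_of_mem c hT)

theorem upFamily_mono {r : ℕ} {F F' : Finset (Finset V)} (h : F ⊆ F') :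
    upFamily r F ⊆ upFamily r F' := by
  intro e he
  rw [mem_upFamily] at he ⊢
  obtain ⟨h1, S, hS, hSe⟩ := he
  exact ⟨h1, S, h hS, hSe⟩

theorem card_upFamily_insert {r s : ℕ} (hs : 1 ≤ s) (hsr : s ≤ r) {S : Finset V} {F : Finset (Finset V)}
    (hF : ∀ T ∈ F, T.card = s) (hS : S.card = s) (hSF : S ∉ F) :
    (upFamily r F).card + (Fintype.card V - s - F.card).choose (r - s) ≤
      (upFamily r (insert S F)).card := by
  obtain ⟨c, hc⟩ := exists_choice_mem_sdiff hs hF hS hSF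
  have h1 := card_le_card (avoiding_subset (r := r) hc)
  rw [card_avoiding (disjoint_image_of_mem_sdiff hc) (by omega), hS,
    card_sdiff_of_subset (upFamily_mono (subset_insert _ _))] at h1
  have h2 : (F.image c).card ≤ F.card := card_image_le
  have h3 := Nat.choose_le_choose (r - s)
    (show Fintype.card V - s - F.card ≤ Fintype.card V - s - (F.image c).card by omega)
  have h4 := card_le_card (upFamily_mono (r := r) (subset_insert S F))
  omega

/-- Among the families of `m` sets of size `s`, stars have the smallest upper shadows. -/
theorem sum_choose_le_card_upFamily {r s : ℕ} (hs : 1 ≤ s) (hsr : s ≤ r) (F : Finset (Finset V))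
    (hF : ∀ T ∈ F, T.card = s) :
    ∑ i ∈ range F.card, (Fintype.card V - s - i).choose (r - s) ≤ (upFamily r F).card := by
  induction F using Finset.induction_on with
  | empty => simp
  | insert S F hSF ih =>
    rw [card_insert_of_notMem hSF, sum_range_succ]
    have := ih fun T hT => hF T (mem_insert_of_mem hT)
    have := card_upFamily_insert hs hsr (fun T hT => hF T (mem_insert_of_mem hT))
      (hF S (mem_insert_self _ _)) hSF
    omega

/-- Equality in the one-step bound. A non-injective c would leave strictly more new sets than
allowed, so the inclusion of `avoiding_subset` is between sets of equal size. This holds for every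
choice c. -/
theorem avoiding_eq_of_card_le {r s : ℕ} (hsr : s < r) {S : Finset V} {F : Finset (Finset V)}
    (hS : S.card = s) (hn : F.card + r ≤ Fintype.card V)
    (h : (upFamily r (insert S F)).card ≤
      (upFamily r F).card + (Fintype.card V - s - F.card).choose (r - s))
    {c : Finset V → V} (hc : ∀ T ∈ F, c T ∈ T \ S) :
    (F.image c).card = F.card ∧
      avoiding r S (F.image c) = upFamily r (insert S F) \ upFamily r F := by
  have h1 := card_le_card (avoiding_subset (r := r) hc)
  have hcard := card_avoiding (r := r) (disjoint_image_of_mem_sdiff hc) (by omega)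
  rw [hS] at hcard
  have hsd := card_sdiff_of_subset (upFamily_mono (r := r) (subset_insert S F))
  have h2 : (F.image c).card ≤ F.card := card_image_le
  have heq : (F.image c).card = F.card := by
    by_contra hne
    have : (Fintype.card V - s - F.card).choose (r - s) <
        (Fintype.card V - s - (F.image c).card).choose (r - s) := by
      calc (Fintype.card V - s - F.card).choose (r - s)
          < (Fintype.card V - s - F.card + 1).choose (r - s) := by
            obtain ⟨k, hk⟩ : ∃ k, r - s = k + 1 := ⟨r - s - 1, by omega⟩
            rw [hk, Nat.choose_succ_succ']
            have : 0 < (Fintype.card V - s - F.card).choose k := Nat.choose_pos (by omega)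
            omega
        _ ≤ _ := Nat.choose_le_choose _ (by omega)
    omega
  refine ⟨heq, eq_of_subset_of_card_le (avoiding_subset hc) ?_⟩
  rw [hcard, heq]
  omega

/-- The choice function may be altered at will. A point common to two differences could be chosen
twice, against injectivity. If T \ S had two points p and q, a new set through p that avoids a
choice with q would not avoid the choice with p, although both choices describe the same new sets.
-/
theorem exchange_of_card_le {r s : ℕ} (hs : 1 ≤ s) (hsr : s < r) {S : Finset V} {F : Finset (Finset V)}
    (hF : ∀ T ∈ F, T.card = s) (hSF : S ∉ F)
    (hS : S.card = s) (hn : F.card + r ≤ Fintype.card V)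
    (h : (upFamily r (insert S F)).card ≤
      (upFamily r F).card + (Fintype.card V - s - F.card).choose (r - s)) :
    (∀ T ∈ F, (T \ S).card = 1) ∧
      ∀ T ∈ F, ∀ T' ∈ F, ∀ x, x ∈ T \ S → x ∈ T' \ S → T = T' := by
  obtain ⟨c₀, hc₀⟩ := exists_choice_mem_sdiff hs hF hS hSF
  have hupd : ∀ T p, p ∈ T \ S → ∀ c : Finset V → V, (∀ T ∈ F, c T ∈ T \ S) →
      ∀ U ∈ F, Function.update c T p U ∈ U \ S := by
    intro T p hp c hc U hU
    rcases eq_or_ne U T with rfl | hne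
    · simpa using hp
    · rw [Function.update_of_ne hne]
      exact hc U hU
  have hinj : ∀ T ∈ F, ∀ T' ∈ F, ∀ x, x ∈ T \ S → x ∈ T' \ S → T = T' := by
    intro T hT T' hT' x hx hx'
    by_contra hne
    have hc := hupd T' x hx' _ (hupd T x hx c₀ hc₀)
    have := card_image_iff.1 (avoiding_eq_of_card_le hsr hS hn h hc).1
    apply hne
    apply this hT hT'
    simp [Function.update_of_ne hne]
  refine ⟨fun T hT => ?_, hinj⟩
  by_contra hne
  have hpos : 0 < (T \ S).card := card_pos.2 ⟨_, hc₀ T hT⟩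
  obtain ⟨p, hp, q, hq, hpq⟩ := one_lt_card.1 (show 1 < (T \ S).card by omega)
  have hcp := hupd T p hp c₀ hc₀
  have hcq := hupd T q hq c₀ hc₀
  have hP := avoiding_eq_of_card_le hsr hS hn h hcp
  have hQ := avoiding_eq_of_card_le hsr hS hn h hcq
  have hpQ : p ∉ F.image (Function.update c₀ T q) := by
    intro hmem
    obtain ⟨U, hU, hUp⟩ := mem_image.1 hmem
    rcases eq_or_ne U T with rfl | hUT
    · simp at hUp
      exact hpq hUp.symm
    · have := hcq U hU
      rw [hUp] at this
      exact hUT (hinj U hU T hT p this hp)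
  have hpS : p ∉ S := (mem_sdiff.1 hp).2
  have hcard := card_avoiding (r := r) (S := insert p S) (P := F.image (Function.update c₀ T q))
    (disjoint_insert_left.2 ⟨hpQ, disjoint_image_of_mem_sdiff hcq⟩)
    (by rw [card_insert_of_notMem hpS]; omega)
  rw [card_insert_of_notMem hpS, hQ.1] at hcard
  have : 0 < (avoiding r (insert p S) (F.image (Function.update c₀ T q))).card := by
    rw [hcard]
    exact Nat.choose_pos (by omega)
  obtain ⟨e, he⟩ := card_pos.1 this
  rw [mem_avoiding] at he
  have : e ∈ avoiding r S (F.image (Function.update c₀ T q)) :=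
    mem_avoiding.2 ⟨he.1, (subset_insert _ _).trans he.2.1, he.2.2⟩
  rw [hQ.2, ← hP.2, mem_avoiding] at this
  refine disjoint_left.1 this.2.2 (he.2.1 (mem_insert_self _ _)) (mem_image.2 ⟨T, hT, by simp⟩)

/-- A family whose upper shadow is as small as that of a star is a star. -/
theorem isStarConfiguration_of_card_upFamily_le {r s : ℕ} (hs : 1 ≤ s) (hsr : s < r)
    {F : Finset (Finset V)} (hF : ∀ T ∈ F, T.card = s) (hne : F.Nonempty)
    (hn : F.card + r ≤ Fintype.card V)
    (h : (upFamily r F).card ≤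
      ∑ i ∈ range F.card, (Fintype.card V - s - i).choose (r - s)) :
    IsStarConfiguration s F := by
  refine ⟨hF, ?_⟩
  -- Any S may be taken as the last set added: the others already contribute the first terms of the
  -- sum, so S adds at most the last term.
  have key : ∀ S ∈ F, (∀ T ∈ F.erase S, (T \ S).card = 1) ∧
      ∀ T ∈ F.erase S, ∀ T' ∈ F.erase S, ∀ x, x ∈ T \ S → x ∈ T' \ S → T = T' := by
    intro S hS
    have hc : (F.erase S).card + 1 = F.card := card_erase_add_one hS
    have hF' : ∀ T ∈ F.erase S, T.card = s := fun T hT => hF T (mem_of_mem_erase hT)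
    refine exchange_of_card_le hs hsr hF' (notMem_erase _ _)
      (hF S hS) (by omega) ?_
    rw [insert_erase hS]
    have := sum_choose_le_card_upFamily hs hsr.le (F.erase S) hF'
    rw [← hc, sum_range_succ] at h
    omega
  have mono : ∀ A : Finset V, s - 1 ≤ A.card → (∀ T ∈ F, A ⊆ T) →
      s - 1 ≤ (univ.filter fun v : V => ∀ A ∈ F, v ∈ A).card := by
    intro A hA hAF
    refine hA.trans (card_le_card fun x hx => ?_)
    simp only [mem_filter, mem_univ, true_and]
    exact fun T hT => hAF T hT hx
  obtain ⟨S, hS⟩ := hne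
  by_cases hS' : (F.erase S).Nonempty
  · obtain ⟨S', hS'⟩ := hS'
    have hS'F := mem_of_mem_erase hS'
    have hSS' : S' ≠ S := ne_of_mem_erase hS'
    have h1 : (S' \ S).card = 1 := (key S hS).1 S' hS'
    have h2 : (S \ S').card = 1 := (key S' hS'F).1 S (mem_erase.2 ⟨hSS'.symm, hS⟩)
    obtain ⟨a, ha⟩ := card_eq_one.1 h2
    have haS : a ∈ S \ S' := by rw [ha]; simp
    rw [mem_sdiff] at haS
    refine mono (S ∩ S') ?_ ?_
    · have := card_sdiff_add_card_inter S S'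
      rw [h2, hF S hS] at this
      omega
    · intro T hT z hz
      rw [mem_inter] at hz
      -- If T missed z, then S \ T = {z} and a ∈ T. The point b of T \ S is not in S', as
      -- differences from S are disjoint, so T \ S' would contain both a and b. This excludes three
      -- s-subsets of one (s+1)-set.
      by_contra hzT
      have hTS : T ≠ S := fun hh => hzT (hh ▸ hz.1)
      have hTS' : T ≠ S' := fun hh => hzT (hh ▸ hz.2)
      have hTe : T ∈ F.erase S := mem_erase.2 ⟨hTS, hT⟩
      have hST : (S \ T).card = 1 := (key T hT).1 S (mem_erase.2 ⟨hTS.symm, hS⟩)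
      have haT : a ∈ T := by
        by_contra haT
        have := card_le_one.1 hST.le a (by simp [haS, haT]) z (by simp [hz, hzT])
        exact haS.2 (this ▸ hz.2)
      obtain ⟨b, hb⟩ := card_pos.1 (show 0 < (T \ S).card by rw [(key S hS).1 T hTe]; omega)
      have hbS' : b ∉ S' := fun hbS' =>
        hTS' ((key S hS).2 T hTe S' hS' b hb (mem_sdiff.2 ⟨hbS', (mem_sdiff.1 hb).2⟩))
      have h3 := (key S' hS'F).1 T (mem_erase.2 ⟨hTS', hT⟩)
      rw [mem_sdiff] at hb
      have := card_le_one.1 h3.le a (by simp [haS, haT]) b (by simp [hb, hbS'])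
      exact hb.2 (this ▸ haS.1)
  · refine mono S (by rw [hF S hS]; omega) fun T hT => ?_
    by_contra hTS
    exact hS' ⟨T, mem_erase.2 ⟨fun hh => hTS hh.ge, hT⟩⟩

/-! ### Structure of star configurations -/

/-- Any (s-1)-subset of the common intersection serves as the centre A, with leaves P; with at most
one member the centre need not be unique. -/
theorem IsStarConfiguration.exists_eq_image {s : ℕ} (hs : 1 ≤ s) {F : Finset (Finset V)}
    (hF : IsStarConfiguration s F) :
    ∃ A P : Finset V, A.card = s - 1 ∧ Disjoint A P ∧ P.card = F.card ∧
      F = P.image fun x => insert x A := by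
  obtain ⟨A, hA, hAc⟩ := exists_subset_card_eq hF.2
  have hAF : ∀ T ∈ F, A ⊆ T := fun T hT x hx => (mem_filter.1 (hA hx)).2 T hT
  have hinj : ∀ P : Finset V, Disjoint A P → Set.InjOn (fun x => insert x A) (P : Set V) := by
    intro P hP x hx y hy hxy
    have hx' : x ∈ insert y A := by
      have : insert x A = insert y A := hxy
      rw [← this]
      simp
    rcases mem_insert.1 hx' with h | h
    · exact h
    · exact absurd hx (disjoint_left.1 hP h)
  let P : Finset V := univ.filter fun x => x ∉ A ∧ insert x A ∈ F
  have hAP : Disjoint A P := disjoint_left.2 fun x hx hxP => (mem_filter.1 hxP).2.1 hx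
  have hFP : F = P.image fun x => insert x A := by
    ext T
    simp only [mem_image, P, mem_filter, mem_univ, true_and]
    constructor
    · intro hT
      have h1 : (T \ A).card = 1 := by
        rw [card_sdiff_of_subset (hAF T hT), hF.1 T hT]
        omega
      obtain ⟨x, hx⟩ := card_eq_one.1 h1
      have hxT : x ∈ T \ A := by rw [hx]; simp
      have hT' : insert x A = T := by
        rw [insert_eq, ← hx, sdiff_union_of_subset (hAF T hT)]
      exact ⟨x, ⟨(mem_sdiff.1 hxT).2, hT' ▸ hT⟩, hT'⟩
    · rintro ⟨x, ⟨-, hx⟩, rfl⟩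
      exact hx
  refine ⟨A, P, hAc, hAP, ?_, hFP⟩
  conv_rhs => rw [hFP]
  rw [card_image_of_injOn (hinj P hAP)]

theorem isStarConfiguration_image {s : ℕ} (hs : 1 ≤ s) {A P : Finset V} (hA : A.card = s - 1)
    (hAP : Disjoint A P) :
    IsStarConfiguration s (P.image fun x => insert x A) ∧
      (P.image fun x => insert x A).card = P.card := by
  refine ⟨⟨?_, ?_⟩, ?_⟩
  · intro T hT
    obtain ⟨x, hx, rfl⟩ := mem_image.1 hT
    rw [card_insert_of_notMem (disjoint_right.1 hAP hx)]
    omega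
  · rw [← hA]
    refine card_le_card fun x hx => ?_
    simp only [mem_filter, mem_univ, true_and, mem_image]
    rintro _ ⟨y, _, rfl⟩
    exact mem_insert_of_mem hx
  · rw [card_image_of_injOn]
    intro x hx y hy hxy
    have hx' : x ∈ insert y A := by
      have : insert x A = insert y A := hxy
      rw [← this]
      simp
    rcases mem_insert.1 hx' with h | h
    · exact h
    · exact absurd hx (disjoint_left.1 hAP h)

theorem exists_isStarConfiguration {s t : ℕ} (hs : 1 ≤ s) (ht : s - 1 + t ≤ Fintype.card V) :
    ∃ F : Finset (Finset V), IsStarConfiguration s F ∧ F.card = t := by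
  obtain ⟨A, -, hA⟩ := exists_subset_card_eq (show s - 1 ≤ (univ : Finset V).card by
    rw [card_univ]; omega)
  obtain ⟨P, hP, hPc⟩ := exists_subset_card_eq (show t ≤ (univ \ A).card by
    rw [card_sdiff_of_subset (subset_univ _), card_univ]; omega)
  have hAP : Disjoint A P := disjoint_left.2 fun x hx hxP => (mem_sdiff.1 (hP hxP)).2 hx
  have := isStarConfiguration_image hs hA hAP
  exact ⟨_, this.1, this.2.trans hPc⟩

/-- The shadow consists of the r-sets containing the centre, except those that avoid every leaf. -/
theorem card_upFamily_of_isStarConfiguration {r s : ℕ} (hs : 1 ≤ s) (hsr : s ≤ r)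
    {F : Finset (Finset V)} (hF : IsStarConfiguration s F) :
    (upFamily r F).card + (Fintype.card V - (s - 1) - F.card).choose (r - (s - 1)) =
      (Fintype.card V - (s - 1)).choose (r - (s - 1)) := by
  obtain ⟨A, P, hA, hAP, hPF, hFP⟩ := hF.exists_eq_image hs
  have h1 := card_avoiding (r := r) hAP (by omega)
  have h2 := card_avoiding (r := r) (disjoint_empty_right A) (by omega)
  have hsub : avoiding r A P ⊆ avoiding r A ∅ := by
    intro e he
    rw [mem_avoiding] at he ⊢
    exact ⟨he.1, he.2.1, disjoint_empty_right _⟩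
  have : upFamily r F = avoiding r A ∅ \ avoiding r A P := by
    ext e
    rw [hFP]
    simp only [mem_sdiff, mem_avoiding, mem_upFamily, mem_image, exists_exists_and_eq_and,
      insert_subset_iff, disjoint_empty_right, and_true]
    constructor
    · rintro ⟨h1, x, hx, hxe, hAe⟩
      exact ⟨⟨h1, hAe⟩, fun h => disjoint_left.1 h.2.2 hxe hx⟩
    · rintro ⟨⟨h1, hAe⟩, h⟩
      refine ⟨h1, ?_⟩
      by_contra hcon
      push Not at hcon
      exact h ⟨h1, hAe, disjoint_left.2 fun x hx hxP => hcon x hxP hx hAe⟩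
  have h3 := card_sdiff_add_card_eq_card hsub
  rw [← this, h1, h2, hA, hPF] at h3
  simpa using h3

/-! ### Numerical estimates -/

/-- Pascal's rule telescopes; this turns the sum in the shadow bound into the closed form of the
theorem. -/
theorem sum_choose_sub (N k t : ℕ) (ht : t ≤ N + 1) :
    ∑ i ∈ range t, (N - i).choose k + (N + 1 - t).choose (k + 1) = (N + 1).choose (k + 1) := by
  induction t with
  | zero => simp
  | succ t ih =>
    rw [sum_range_succ, ← ih (by omega), show N + 1 - t = (N - t) + 1 by omega,
      Nat.choose_succ_succ, show N + 1 - (t + 1) = N - t by omega]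
    ring

/-- Source of the constants D (with k = r) and E (with k = r - s) below. -/
theorem pow_le_mul_choose {n m k : ℕ} (h : n ≤ 2 * (m + 1 - k)) :
    n ^ k ≤ 2 ^ k * k.factorial * m.choose k := by
  calc n ^ k ≤ (2 * (m + 1 - k)) ^ k := Nat.pow_le_pow_left h k
    _ = 2 ^ k * (m + 1 - k) ^ k := by rw [mul_pow]
    _ ≤ 2 ^ k * m.descFactorial k := Nat.mul_le_mul_left _ (Nat.pow_sub_le_descFactorial _ _)
    _ = _ := by rw [Nat.descFactorial_eq_factorial_mul_choose, mul_assoc]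

theorem card_avoiding_empty_le {r a : ℕ} {T : Finset V} (haT : a ≤ T.card)
    (hV : 0 < Fintype.card V) : (avoiding r T ∅).card ≤ Fintype.card V ^ (r - a) := by
  by_cases hT : T.card ≤ r
  · rw [card_avoiding (disjoint_empty_right _) hT]
    calc _ ≤ (Fintype.card V - T.card - (∅ : Finset V).card) ^ (r - T.card) := Nat.choose_le_pow _ _
      _ ≤ Fintype.card V ^ (r - T.card) := Nat.pow_le_pow_left (by omega) _
      _ ≤ _ := Nat.pow_le_pow_right hV (by omega)
  · have : avoiding r T ∅ = ∅ := by
      rw [eq_empty_iff_forall_notMem]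
      intro e he
      rw [mem_avoiding] at he
      have := card_le_card he.2.1
      omega
    simp [this]

/-! ### Kernel of the inclusion matrix and its support -/

/-- The kernel of the inclusion matrix, restricted to the union of the supports of its members. -/
theorem exists_support_submodule (s t : ℕ) (G : Finset (Finset V))
    (h : inclusionRank s G + t ≤ (Fintype.card V).choose s) :
    ∃ F : Finset (Finset V), (∀ S ∈ F, S.card = s) ∧ ∃ W : Submodule ℝ (F → ℝ),
      t ≤ Module.finrank ℝ W ∧ (∀ S : F, ∃ w ∈ W, w S ≠ 0) ∧
      ∀ w ∈ W, ∀ e ∈ G, ∑ S : F with S.1 ⊆ e, w S = 0 := by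
  classical
  let M := inclusionMatrix s G
  let K : Submodule ℝ ({S : Finset V // S.card = s} → ℝ) := LinearMap.ker M.mulVecLin
  have hK : t ≤ Module.finrank ℝ K := by
    have h1 := LinearMap.finrank_range_add_finrank_ker M.mulVecLin
    rw [Module.finrank_fintype_fun_eq_card, Fintype.card_finset_len] at h1
    change inclusionRank s G + Module.finrank ℝ K = _ at h1
    omega
  let F' : Finset {S : Finset V // S.card = s} := univ.filter fun S => ∃ w ∈ K, w S ≠ 0
  let F : Finset (Finset V) := F'.image Subtype.val
  have hF : ∀ S ∈ F, S.card = s := by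
    intro S hS
    obtain ⟨S, -, rfl⟩ := mem_image.1 hS
    exact S.2
  have hFK : ∀ S : F, ∃ w ∈ K, w ⟨S.1, hF S.1 S.2⟩ ≠ 0 := by
    rintro ⟨S, hS⟩
    obtain ⟨S', hS', rfl⟩ := mem_image.1 hS
    exact (mem_filter.1 hS').2
  have hKF : ∀ w ∈ K, ∀ S : {S : Finset V // S.card = s}, S.1 ∉ F → w S = 0 := by
    intro w hw S hS
    by_contra hne
    exact hS (mem_image_of_mem _ (mem_filter.2 ⟨mem_univ _, w, hw, hne⟩))
  let ρ : ({S : Finset V // S.card = s} → ℝ) →ₗ[ℝ] (F → ℝ) :=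
    LinearMap.funLeft ℝ ℝ fun S : F => ⟨S.1, hF S.1 S.2⟩
  -- Kernel vectors vanish off F, so restricting them to F loses no dimension.
  have hinj : Function.Injective (ρ.domRestrict K) := by
    rw [← LinearMap.ker_eq_bot, LinearMap.ker_eq_bot']
    rintro ⟨w, hw⟩ h0
    ext S
    by_cases hS : S.1 ∈ F
    · exact congrFun h0 ⟨S.1, hS⟩
    · exact hKF w hw S hS
  refine ⟨F, hF, LinearMap.range (ρ.domRestrict K), ?_, ?_, ?_⟩
  · rwa [LinearMap.finrank_range_of_inj hinj]
  · intro S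
    obtain ⟨w, hw, hne⟩ := hFK S
    exact ⟨_, ⟨⟨w, hw⟩, rfl⟩, hne⟩
  · rintro _ ⟨⟨w, hw⟩, rfl⟩ e he
    have h0 : ∑ S : {S : Finset V // S.card = s}, (if S.1 ⊆ e then (1 : ℝ) else 0) * w S = 0 :=
      congrFun (LinearMap.mem_ker.1 hw) ⟨e, he⟩
    have h1 : ∑ S : {S : Finset V // S.card = s} with S.1 ⊆ e, w S = 0 := by
      simpa [sum_filter] using h0
    rw [← h1]
    refine sum_bij_ne_zero (fun S _ _ => (⟨S.1, hF S.1 S.2⟩ : {S : Finset V // S.card = s}))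
      ?_ ?_ ?_ ?_
    · intro S hS _
      simpa using hS
    · intro S _ _ S' _ _ hSS'
      exact Subtype.ext (congrArg (fun S => S.1) hSS')
    · intro S hS hne
      by_cases hSF : S.1 ∈ F
      · exact ⟨⟨S.1, hSF⟩, by simpa using hS, hne, rfl⟩
      · exact absurd (hKF w hw S hSF) hne
    · intro S _ _
      rfl

/-- Count the r-sets T disjoint from S. Some r-subset e of S ∪ T lies in H, since otherwise
injectivity on S ∪ T gives `w S = 0`; and e \ S ⊆ T. If S ⊆ e, this leaves s free points of T,
otherwise at most s - 1. -/
theorem choose_le_of_mem_support {r s : ℕ} (hs : 1 ≤ s) (hsr : s ≤ r) (hV : 0 < Fintype.card V)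
    {F H : Finset (Finset V)} (hF : ∀ S ∈ F, S.card = s) {w : F → ℝ}
    (hw : ∀ e : Finset V, e.card = r → e ∉ H → ∑ S : F with S.1 ⊆ e, w S = 0)
    (hH : ∀ e ∈ H, e.card = r) (S : F) (hS : w S ≠ 0) :
    (Fintype.card V - s).choose r ≤
      (H.filter fun e => S.1 ⊆ e).card * Fintype.card V ^ s + H.card * Fintype.card V ^ (s - 1) := by
  obtain ⟨S, hSF⟩ := S
  have hSs := hF S hSF
  let f : Finset V → ℝ := fun T => if h : T ∈ F then w ⟨T, h⟩ else 0
  have hf : ∀ e : Finset V, ∑ T ∈ powersetCard s e, f T = ∑ S : F with S.1 ⊆ e, w S := by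
    intro e
    symm
    refine sum_bij_ne_zero (fun S _ _ => S.1) ?_ ?_ ?_ ?_
    · intro S hS _
      exact mem_powersetCard.2 ⟨by simpa using hS, hF S.1 S.2⟩
    · intro S _ _ S' _ _ h
      exact Subtype.ext h
    · intro T hT hne
      by_cases hTF : T ∈ F
      · exact ⟨⟨T, hTF⟩, by simpa using (mem_powersetCard.1 hT).1, by simpa [f, hTF] using hne, rfl⟩
      · simp [f, hTF] at hne
    · intro S _ _
      simp [f]
  have hcover : powersetCard r (univ \ S) ⊆
      ((H.filter fun e => S ⊆ e).biUnion fun e => avoiding r (e \ S) ∅) ∪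
      ((H.filter fun e => ¬ S ⊆ e).biUnion fun e => avoiding r (e \ S) ∅) := by
    rw [← union_biUnion, filter_union_filter_not_eq]
    intro T hT
    rw [mem_powersetCard] at hT
    have hST : Disjoint S T := disjoint_left.2 fun x hx hxT => by
      simpa [hx] using hT.1 hxT
    have : ∃ e ∈ powersetCard r (S ∪ T), e ∈ H := by
      by_contra! hcon
      have h0 := eq_zero_of_sum_powersetCard_eq_zero s r (S ∪ T) f hsr
        (by rw [card_union_of_disjoint hST]; omega)
        (fun e he => by rw [hf, hw e (mem_powersetCard.1 he).2 (hcon e he)]) S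
        (mem_powersetCard.2 ⟨subset_union_left, hSs⟩)
      simp only [f, hSF, dif_pos] at h0
      exact hS h0
    obtain ⟨e, he, heH⟩ := this
    rw [mem_powersetCard] at he
    refine mem_biUnion.2 ⟨e, heH, mem_avoiding.2 ⟨hT.2, ?_, disjoint_empty_right _⟩⟩
    intro x hx
    rw [mem_sdiff] at hx
    exact (mem_union.1 (he.1 hx.1)).resolve_left hx.2
  have hcard := card_le_card hcover
  rw [card_powersetCard, card_sdiff_of_subset (subset_univ _), card_univ, hSs] at hcard
  refine hcard.trans ((card_union_le _ _).trans (Nat.add_le_add ?_ ?_))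
  · refine card_biUnion_le_card_mul _ _ _ fun e he => ?_
    rw [mem_filter] at he
    refine (card_avoiding_empty_le (a := r - s) ?_ hV).trans
      (Nat.pow_le_pow_right hV (by omega))
    rw [card_sdiff_of_subset he.2, hH e he.1, hSs]
  · refine (card_biUnion_le_card_mul _ _ (Fintype.card V ^ (s - 1)) fun e he => ?_).trans
      (Nat.mul_le_mul_right _ (card_filter_le _ _))
    rw [mem_filter] at he
    refine (card_avoiding_empty_le (a := r - s + 1) ?_ hV).trans
      (Nat.pow_le_pow_right hV (by omega))
    have h1 := card_sdiff_add_card_inter e S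
    have h2 : (e ∩ S).card < S.card := by
      refine card_lt_card ⟨inter_subset_right, fun h => he.2 (h.trans inter_subset_left)⟩
    have := hH e he.1
    omega

/-- The members of the upper shadow outside `H` number at most quadratically many in the
codimension of `W`. -/
theorem card_upFamily_sdiff_le {r s k : ℕ} (hV : 0 < Fintype.card V)
    {F H : Finset (Finset V)} (hF : ∀ S ∈ F, S.card = s) (W : Submodule ℝ (F → ℝ))
    (hk : F.card ≤ Module.finrank ℝ W + k) (hne : ∀ S : F, ∃ w ∈ W, w S ≠ 0)
    (hW : ∀ w ∈ W, ∀ e : Finset V, e.card = r → e ∉ H → ∑ S : F with S.1 ⊆ e, w S = 0) :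
    (upFamily r F \ H).card ≤ (k * r.choose s) ^ 2 * Fintype.card V ^ (r - (s + 1)) := by
  let L : Finset (Finset F) := (upFamily r F \ H).image fun e => univ.filter fun S : F => S.1 ⊆ e
  have hmem : ∀ e ∈ upFamily r F \ H, e.card = r ∧ (∃ S ∈ F, S ⊆ e) ∧ e ∉ H := by
    intro e he
    rw [mem_sdiff, mem_upFamily] at he
    exact ⟨he.1.1, he.1.2, he.2⟩
  have hU := card_biUnion_le_of_orthogonal W k (r.choose s) (by simpa using hk) L
    (by
      intro A hA
      obtain ⟨e, he, rfl⟩ := mem_image.1 hA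
      rw [← (hmem e he).1, ← card_powersetCard]
      refine card_le_card_of_injOn Subtype.val ?_ Subtype.val_injective.injOn
      intro S hS
      exact mem_coe.2 (mem_powersetCard.2 ⟨by simpa using hS, hF S.1 S.2⟩))
    (by
      intro A hA w hw
      obtain ⟨e, he, rfl⟩ := mem_image.1 hA
      exact hW w hw e (hmem e he).1 (hmem e he).2.2)
  let U := L.biUnion id
  -- Some w ∈ W is nonzero at a member S of F inside e; as the sum of w over e vanishes, e contains
  -- a second member of F, and both lie in U.
  have hcover : upFamily r F \ H ⊆ U.offDiag.biUnion fun p => avoiding r (p.1.1 ∪ p.2.1) ∅ := by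
    intro e he
    obtain ⟨her, ⟨S, hSF, hSe⟩, heH⟩ := hmem e he
    have hUe : ∀ T : F, T.1 ⊆ e → T ∈ U := fun T hT =>
      mem_biUnion.2 ⟨_, mem_image_of_mem _ he, by simpa using hT⟩
    obtain ⟨w, hw, hwS⟩ := hne ⟨S, hSF⟩
    have : ∃ T : F, T.1 ⊆ e ∧ T ≠ ⟨S, hSF⟩ := by
      by_contra! hcon
      have h0 := hW w hw e her heH
      rw [sum_eq_single (⟨S, hSF⟩ : F) (fun T hT hTS => absurd (hcon T (by simpa using hT)) hTS)
        (fun h => absurd (by simpa using hSe) h)] at h0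
      exact hwS h0
    obtain ⟨T, hTe, hTS⟩ := this
    exact mem_biUnion.2 ⟨(T, ⟨S, hSF⟩), mem_offDiag.2 ⟨hUe _ hTe, hUe _ hSe, hTS⟩,
      mem_avoiding.2 ⟨her, union_subset hTe hSe, disjoint_empty_right _⟩⟩
  calc (upFamily r F \ H).card ≤ U.offDiag.card * Fintype.card V ^ (r - (s + 1)) := by
        refine (card_le_card hcover).trans (card_biUnion_le_card_mul _ _ _ fun p hp => ?_)
        rw [mem_offDiag] at hp
        refine card_avoiding_empty_le ?_ hV
        rw [← hF p.1.1 p.1.2]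
        refine card_lt_card ⟨subset_union_left, fun h => hp.2.2 (Subtype.ext ?_)⟩
        exact (eq_of_subset_of_card_le (subset_union_right.trans h)
          (by rw [hF _ p.1.2, hF _ p.2.2])).symm
    _ ≤ _ := by
        refine Nat.mul_le_mul_right _ ?_
        rw [offDiag_card, sq]
        exact (Nat.sub_le _ _).trans (Nat.mul_le_mul hU hU)

/-- Since t ≤ n / (2D), the term with `H.card` in `choose_le_of_mem_support` costs at most half of
n^r, so every S ∈ F has degree at least n^(r-s) / (2D) in H. Counting pairs S ⊆ e then bounds F. -/
theorem card_support_le {r s t : ℕ} (hs : 1 ≤ s) (hsr : s < r) (hV : 4 * r ≤ Fintype.card V)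
    (ht : 2 * (2 ^ r * r.factorial) * t ≤ Fintype.card V)
    {F H : Finset (Finset V)} (hF : ∀ S ∈ F, S.card = s) (W : Submodule ℝ (F → ℝ))
    (hne : ∀ S : F, ∃ w ∈ W, w S ≠ 0)
    (hW : ∀ w ∈ W, ∀ e : Finset V, e.card = r → e ∉ H → ∑ S : F with S.1 ⊆ e, w S = 0)
    (hH : ∀ e ∈ H, e.card = r) (hcard : H.card ≤ t * Fintype.card V ^ (r - s)) :
    F.card ≤ 2 * (2 ^ r * r.factorial) * r.choose s * t := by
  set n := Fintype.card V with hn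
  set D := 2 ^ r * r.factorial with hD
  have hn0 : 0 < n := by omega
  have hdeg : ∀ S ∈ F, n ^ (r - s) ≤ 2 * D * (H.filter fun e => S ⊆ e).card := by
    intro S hS
    obtain ⟨w, hw, hwS⟩ := hne ⟨S, hS⟩
    have h1 := choose_le_of_mem_support hs hsr.le hn0 hF (hW w hw) hH ⟨S, hS⟩ hwS
    simp only [← hn] at h1
    set d := (H.filter fun e => S ⊆ e).card
    have h2 : n ^ r ≤ D * (n - s).choose r := pow_le_mul_choose (by omega)
    have h3 : n ^ r = n ^ (r - s) * n ^ s := by rw [← pow_add]; congr 1; omega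
    have h4 : n ^ r = n * n ^ (r - s) * n ^ (s - 1) := by
      rw [mul_assoc, ← pow_add, ← pow_succ']
      congr 1
      omega
    have h5 : n ^ r ≤ D * d * n ^ s + D * t * n ^ (r - s) * n ^ (s - 1) :=
      calc n ^ r ≤ D * (n - s).choose r := h2
        _ ≤ D * (d * n ^ s + (t * n ^ (r - s)) * n ^ (s - 1)) :=
          Nat.mul_le_mul_left _ (h1.trans
            (Nat.add_le_add_left (Nat.mul_le_mul_right _ hcard) _))
        _ = _ := by ring
    have h6 : 2 * D * t * (n ^ (r - s) * n ^ (s - 1)) ≤ n ^ r := by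
      rw [h4, mul_assoc n]
      exact Nat.mul_le_mul_right _ ht
    have h7 : n ^ (r - s) * n ^ s ≤ 2 * D * d * n ^ s := by
      rw [← h3]
      nlinarith
    exact Nat.le_of_mul_le_mul_right h7 (by positivity)
  have hsum : F.card * n ^ (r - s) ≤ 2 * D * r.choose s * t * n ^ (r - s) :=
    calc F.card * n ^ (r - s) = ∑ _S ∈ F, n ^ (r - s) := by simp
      _ ≤ ∑ S ∈ F, 2 * D * (H.filter fun e => S ⊆ e).card := sum_le_sum hdeg
      _ = 2 * D * ∑ e ∈ H, (F.filter fun S => S ⊆ e).card := by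
        rw [← mul_sum]
        congr 1
        exact sum_card_bipartiteAbove_eq_sum_card_bipartiteBelow _
      _ ≤ 2 * D * (H.card * r.choose s) := by
        refine Nat.mul_le_mul_left _ ?_
        rw [← smul_eq_mul]
        refine sum_le_card_nsmul _ _ _ fun e he => ?_
        rw [← hH e he, ← card_powersetCard]
        refine card_le_card fun S hS => ?_
        rw [mem_filter] at hS
        exact mem_powersetCard.2 ⟨hS.2, hF S hS.1⟩
      _ ≤ 2 * D * (t * n ^ (r - s) * r.choose s) :=
        Nat.mul_le_mul_left _ (Nat.mul_le_mul_right _ hcard)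
      _ = _ := by ring
  exact Nat.le_of_mul_le_mul_right hsum (by positivity)

/-! ### Stability: extremal graphs come from stars -/

/-- The reciprocal of the constant `c₀` in the main theorem. -/
def thresholdConstant (r s : ℕ) : ℕ :=
  4 * (2 ^ (r - s) * (r - s).factorial) * r.choose s ^ 2 *
    (2 * (2 ^ r * r.factorial) * r.choose s)

theorem four_le_thresholdConstant {r s : ℕ} (hsr : s < r) : 4 ≤ thresholdConstant r s := by
  have := Nat.choose_pos hsr.le
  unfold thresholdConstant
  rw [mul_assoc 4, mul_assoc 4]
  exact Nat.le_mul_of_pos_right _ (by positivity)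

/-- A graph of small rank with at least as many edges as the extremal one is the
complement of the upper shadow of a star. -/
theorem exists_isStarConfiguration_of_card_le {r s t : ℕ} (hs : 1 ≤ s) (hsr : s < r)
    (hV : 4 * r ≤ Fintype.card V) (ht1 : 1 ≤ t)
    (ht : thresholdConstant r s * t ≤ Fintype.card V) {G : Finset (Finset V)}
    (hrank : inclusionRank s G + t ≤ (Fintype.card V).choose s)
    (hcard : (powersetCard r univ \ G).card ≤
      ∑ i ∈ range t, (Fintype.card V - s - i).choose (r - s)) :
    ∃ F, IsStarConfiguration s F ∧ F.card = t ∧ powersetCard r univ \ G = upFamily r F := by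
  obtain ⟨F, hF, W, hWt, hne, hW⟩ := exists_support_submodule s t G hrank
  set H := powersetCard r univ \ G with hHdef
  set n := Fintype.card V with hn
  have hn0 : 0 < n := by omega
  have hH : ∀ e ∈ H, e.card = r := fun e he => (mem_powersetCard.1 (mem_sdiff.1 he).1).2
  have hWH : ∀ w ∈ W, ∀ e : Finset V, e.card = r → e ∉ H →
      ∑ S : F with S.1 ⊆ e, w S = 0 := by
    intro w hw e her he
    refine hW w hw e ?_
    by_contra heG
    exact he (mem_sdiff.2 ⟨mem_powersetCard.2 ⟨subset_univ _, her⟩, heG⟩)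
  have hHt : H.card ≤ t * n ^ (r - s) := by
    refine hcard.trans ?_
    rw [← card_range t, ← smul_eq_mul, card_range]
    nth_rewrite 2 [← card_range t]
    refine sum_le_card_nsmul _ _ _ fun i _ => ?_
    exact (Nat.choose_le_pow _ _).trans (Nat.pow_le_pow_left (by omega) _)
  have hR : 0 < r.choose s := Nat.choose_pos hsr.le
  unfold thresholdConstant at ht
  set E := 2 ^ (r - s) * (r - s).factorial with hE
  set D := 2 ^ r * r.factorial with hD
  set R := r.choose s with hRdef
  have hE0 : 0 < E := by positivity
  have hD0 : 0 < D := by positivity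
  -- With `hm` this gives 4 |F| ≤ n, which keeps n - s - |F| of order n.
  have ht2 : 4 * (2 * D * R * t) ≤ n := by
    refine le_trans ?_ ht
    have : 1 ≤ E * R ^ 2 := Nat.succ_le_of_lt (by positivity)
    calc 4 * (2 * D * R * t) = 1 * (4 * (2 * D * R * t)) := by ring
      _ ≤ (E * R ^ 2) * (4 * (2 * D * R * t)) := Nat.mul_le_mul_right _ this
      _ = _ := by ring
  have hm := card_support_le hs hsr hV (by
    refine le_trans ?_ ht2
    calc 2 * D * t = 2 * D * t * 1 := by ring
      _ ≤ 2 * D * t * (4 * R) := Nat.mul_le_mul_left _ (by omega)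
      _ = _ := by ring) hF W hne hWH hH hHt
  simp only [← hD, ← hRdef] at hm
  have htm : t ≤ F.card := by
    have := Submodule.finrank_le W
    rw [Module.finrank_fintype_fun_eq_card, Fintype.card_coe] at this
    omega
  have hlost := card_upFamily_sdiff_le (r := r) (H := H) (k := F.card - t) hn0 hF W (by omega)
    hne hWH
  have hup := sum_choose_le_card_upFamily hs hsr.le F hF
  simp only [← hn, ← hRdef] at hlost hup
  have hupH : (upFamily r F).card ≤ (upFamily r F \ H).card + H.card :=
    card_le_card_sdiff_add_card
  obtain ⟨k, hk⟩ : ∃ k, F.card = t + k := ⟨F.card - t, by omega⟩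
  have hsplit : ∑ i ∈ range t, (n - s - i).choose (r - s) +
      k * (n - s - F.card).choose (r - s) ≤
      ∑ i ∈ range F.card, (n - s - i).choose (r - s) := by
    rw [hk, sum_range_add]
    refine Nat.add_le_add_left ?_ _
    rw [← hk]
    nth_rewrite 1 [← card_range k]
    rw [← smul_eq_mul]
    refine card_nsmul_le_sum _ _ _ fun i hi => Nat.choose_le_choose _ ?_
    rw [mem_range] at hi
    omega
  rw [show F.card - t = k by omega] at hlost
  have hk0 : k = 0 := by
    by_contra hkne
    have h1 : n ^ (r - s) ≤ E * (n - s - F.card).choose (r - s) := pow_le_mul_choose (by omega)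
    -- The first t terms cancel against `hcard`: the k surplus members of F must be paid for by
    -- shadow sets outside H.
    have h2 : k * (n - s - F.card).choose (r - s) ≤ (k * R) ^ 2 * n ^ (r - (s + 1)) := by omega
    have h3 : n ^ (r - s) = n * n ^ (r - (s + 1)) := by
      rw [← pow_succ']
      congr 1
      omega
    have h4 : n * (k * n ^ (r - (s + 1))) ≤ E * R ^ 2 * k * (k * n ^ (r - (s + 1))) :=
      calc n * (k * n ^ (r - (s + 1))) = k * n ^ (r - s) := by rw [h3]; ring
        _ ≤ k * (E * (n - s - F.card).choose (r - s)) := Nat.mul_le_mul_left _ h1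
        _ = E * (k * (n - s - F.card).choose (r - s)) := by ring
        _ ≤ E * ((k * R) ^ 2 * n ^ (r - (s + 1))) := Nat.mul_le_mul_left _ h2
        _ = _ := by ring
    -- Now n is at most linear in k ≤ |F|, which the size of `thresholdConstant` rules out.
    have h5 : n ≤ E * R ^ 2 * k :=
      Nat.le_of_mul_le_mul_right h4 (Nat.mul_pos (Nat.pos_of_ne_zero hkne) (by positivity))
    have h6 : E * R ^ 2 * k ≤ E * R ^ 2 * (2 * D * R * t) := Nat.mul_le_mul_left _ (by omega)
    have h7 : 4 * (E * R ^ 2 * (2 * D * R * t)) ≤ n := by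
      refine le_trans (le_of_eq ?_) ht
      ring
    omega
  subst hk0
  -- For k = 0 the bound on shadow sets outside H is 0.
  have hsub : upFamily r F ⊆ H := by
    rw [← sdiff_eq_empty_iff_subset, ← card_eq_zero]
    simpa using hlost
  have hFt : F.card = t := by omega
  rw [hFt] at hup
  have hle := card_le_card hsub
  refine ⟨F, ?_, hFt, (eq_of_subset_of_card_le hsub (hcard.trans hup)).symm⟩
  refine isStarConfiguration_of_card_upFamily_le hs hsr hF (card_pos.1 (by omega)) ?_ ?_
  · omega
  · rw [hFt]
    exact hle.trans hcard

/-! ### Star complements and isomorphism -/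

theorem completeMinusUpShadow_eq {r s : ℕ} (hsr : s ≤ r) {F : Finset (Finset V)}
    (hF : ∀ S ∈ F, S.card = s) :
    completeMinusUpShadow r s F = powersetCard r univ \ upFamily r F := by
  ext e
  simp only [completeMinusUpShadow, mem_sdiff, mem_powersetCard, mem_upFamily,
    mem_upShadow_iterate_iff_exists_mem_card_add]
  constructor
  · rintro ⟨h1, h2⟩
    refine ⟨h1, ?_⟩
    rintro ⟨-, S, hS, hSe⟩
    exact h2 ⟨S, hS, hSe, by rw [hF S hS, h1.2]; omega⟩
  · rintro ⟨h1, h2⟩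
    refine ⟨h1, ?_⟩
    rintro ⟨S, hS, hSe, -⟩
    exact h2 ⟨h1.2, S, hS, hSe⟩

/-- No remaining edge contains a member of F, so the columns indexed by F are zero and only the
others can contribute to the rank. -/
theorem inclusionRank_complement_upFamily_add_le {r s : ℕ} {F : Finset (Finset V)}
    (hF : ∀ S ∈ F, S.card = s) :
    inclusionRank s (powersetCard r univ \ upFamily r F) + F.card ≤
      (Fintype.card V).choose s := by
  classical
  set G := powersetCard r univ \ upFamily r F with hG
  let F' : Finset {S : Finset V // S.card = s} := univ.filter fun S => S.1 ∉ F
  have hle : Submodule.span ℝ (Set.range (inclusionMatrix s G).col) ≤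
      Submodule.span ℝ ((F'.image (inclusionMatrix s G).col : Finset _) : Set _) := by
    rw [Submodule.span_le]
    rintro _ ⟨S, rfl⟩
    by_cases hS : S.1 ∈ F
    · have : (inclusionMatrix s G).col S = 0 := by
        ext e
        have he := e.2
        simp only [hG, mem_sdiff, mem_powersetCard, mem_upFamily] at he
        have : ¬ S.1 ⊆ e.1 := fun h => he.2 ⟨he.1.2, S.1, hS, h⟩
        simp [inclusionMatrix, this]
      rw [this]
      exact Submodule.zero_mem _
    · exact Submodule.subset_span (mem_coe.2 (mem_image_of_mem _ (by simpa [F'] using hS)))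
  have h1 : inclusionRank s G ≤ F'.card := by
    rw [inclusionRank, Matrix.rank_eq_finrank_span_cols]
    exact (Submodule.finrank_mono hle).trans ((finrank_span_finset_le_card _).trans card_image_le)
  have h2 : F.card ≤ (univ.filter fun S : {S : Finset V // S.card = s} => ¬ S.1 ∉ F).card := by
    refine card_le_card_of_surjOn Subtype.val ?_
    intro S hS
    exact ⟨⟨S, hF S hS⟩, by simpa using hS, rfl⟩
  have h3 := card_filter_add_card_filter_not (s := univ)
    (fun S : {S : Finset V // S.card = s} => S.1 ∉ F)
  rw [card_univ, Fintype.card_finset_len] at h3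
  have : F'.card = (univ.filter fun S : {S : Finset V // S.card = s} => S.1 ∉ F).card := rfl
  omega

theorem image_complement_upFamily (r : ℕ) (F : Finset (Finset V)) (σ : Equiv.Perm V) :
    (powersetCard r univ \ upFamily r F).image (fun e => e.image σ) =
      powersetCard r univ \ upFamily r (F.image fun S => S.image σ) := by
  ext e
  have hinv : ∀ e : Finset V, (e.image σ.symm).image σ = e := fun e => by
    simp [image_image]
  simp only [mem_image, mem_sdiff, mem_powersetCard, mem_upFamily, exists_exists_and_eq_and]
  constructor
  · rintro ⟨e, ⟨⟨-, h1⟩, h2⟩, rfl⟩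
    have h1' : (e.image σ).card = r := by rw [card_image_of_injective _ σ.injective, h1]
    refine ⟨⟨subset_univ _, h1'⟩, ?_⟩
    rintro ⟨-, S, hS, hSe⟩
    exact h2 ⟨h1, S, hS, (image_subset_image_iff σ.injective).1 hSe⟩
  · rintro ⟨⟨-, h1⟩, h2⟩
    refine ⟨e.image σ.symm, ⟨⟨subset_univ _, ?_⟩, ?_⟩, hinv e⟩
    · rw [card_image_of_injective _ σ.symm.injective, h1]
    · rintro ⟨-, S, hS, hSe⟩
      exact h2 ⟨h1, S, hS, hinv e ▸ image_subset_image hSe⟩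

theorem IsStarConfiguration.image_perm {s : ℕ} (hs : 1 ≤ s) {F : Finset (Finset V)}
    (hF : IsStarConfiguration s F) (σ : Equiv.Perm V) :
    IsStarConfiguration s (F.image fun S => S.image σ) ∧
      (F.image fun S => S.image σ).card = F.card := by
  obtain ⟨A, P, hA, hAP, hPF, rfl⟩ := hF.exists_eq_image hs
  have h := isStarConfiguration_image hs (A := A.image σ) (P := P.image σ)
    (by rw [card_image_of_injective _ σ.injective, hA])
    ((disjoint_image σ.injective).2 hAP)
  have heq : (P.image fun x => insert x A).image (fun S => S.image σ) =
      (P.image σ).image fun x => insert x (A.image σ) := by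
    rw [image_image, image_image]
    exact image_congr fun x _ => by simp [image_insert]
  rw [heq]
  exact ⟨h.1, h.2.trans ((card_image_of_injective _ σ.injective).trans hPF)⟩

/-- Match centre with centre and leaves with leaves, then extend to a permutation of V. -/
theorem IsStarConfiguration.exists_perm {s : ℕ} (hs : 1 ≤ s) {F F' : Finset (Finset V)}
    (hF : IsStarConfiguration s F) (hF' : IsStarConfiguration s F') (hc : F.card = F'.card) :
    ∃ σ : Equiv.Perm V, F.image (fun S => S.image σ) = F' := by
  obtain ⟨A, P, hA, hAP, hPF, rfl⟩ := hF.exists_eq_image hs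
  obtain ⟨A', P', hA', hAP', hPF', rfl⟩ := hF'.exists_eq_image hs
  let a := equivOfCardEq (hA.trans hA'.symm)
  let p := equivOfCardEq (hPF.trans (hc.trans hPF'.symm))
  let f : V → V := fun x => if h : x ∈ A then a ⟨x, h⟩ else if h : x ∈ P then p ⟨x, h⟩ else x
  have hfA : ∀ x (h : x ∈ A), f x = a ⟨x, h⟩ := fun x h => by simp [f, h]
  have hfP : ∀ x (h : x ∈ P), f x = p ⟨x, h⟩ := fun x h => by
    simp [f, h, disjoint_right.1 hAP h]
  have hinj : Set.InjOn f (A ∪ P : Finset V) := by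
    intro x hx y hy hxy
    rcases mem_union.1 (mem_coe.1 hx) with hx | hx <;>
      rcases mem_union.1 (mem_coe.1 hy) with hy | hy
    · rw [hfA x hx, hfA y hy] at hxy
      simpa using a.injective (Subtype.ext hxy)
    · rw [hfA x hx, hfP y hy] at hxy
      exact absurd (hxy ▸ (p ⟨y, hy⟩).2) (disjoint_left.1 hAP' (a ⟨x, hx⟩).2)
    · rw [hfP x hx, hfA y hy] at hxy
      exact absurd (hxy ▸ (a ⟨y, hy⟩).2) (disjoint_right.1 hAP' (p ⟨x, hx⟩).2)
    · rw [hfP x hx, hfP y hy] at hxy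
      simpa using p.injective (Subtype.ext hxy)
  obtain ⟨g, hg⟩ := exists_equiv_extend_of_card_eq (t := (univ : Finset V)) (card_univ).symm
    (subset_univ _) hinj
  let σ : Equiv.Perm V := g.trans (Equiv.subtypeUnivEquiv fun x => mem_univ x)
  have hσ : ∀ x ∈ A ∪ P, σ x = f x := hg
  have hσA : A.image σ = A' := by
    refine eq_of_subset_of_card_le ?_ (by
      rw [card_image_of_injective _ σ.injective, hA, hA'])
    intro y hy
    obtain ⟨x, hx, rfl⟩ := mem_image.1 hy
    rw [hσ x (mem_union_left _ hx), hfA x hx]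
    exact (a _).2
  have hσP : P.image σ = P' := by
    refine eq_of_subset_of_card_le ?_ (by
      rw [card_image_of_injective _ σ.injective, hPF, hc, hPF'])
    intro y hy
    obtain ⟨x, hx, rfl⟩ := mem_image.1 hy
    rw [hσ x (mem_union_right _ hx), hfP x hx]
    exact (p _).2
  refine ⟨σ, ?_⟩
  rw [← hσP, image_image, image_image]
  exact image_congr fun x _ => by simp [image_insert, hσA]

theorem card_upFamily_eq_sum {r s : ℕ} (hs : 1 ≤ s) (hsr : s ≤ r) {F : Finset (Finset V)}
    (hF : IsStarConfiguration s F) (hn : s + F.card ≤ Fintype.card V) :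
    (upFamily r F).card = ∑ i ∈ range F.card, (Fintype.card V - s - i).choose (r - s) := by
  have h1 := card_upFamily_of_isStarConfiguration hs hsr hF
  have h2 := sum_choose_sub (Fintype.card V - s) (r - s) F.card (by omega)
  rw [show Fintype.card V - (s - 1) = Fintype.card V - s + 1 by omega,
    show r - (s - 1) = r - s + 1 by omega] at h1
  omega

theorem card_add_card_complement {r : ℕ} {G : Finset (Finset V)} (hG : IsRGraph r G) :
    (powersetCard r univ \ G).card + G.card = (Fintype.card V).choose r := by
  rw [card_sdiff_add_card_eq_card, card_powersetCard, card_univ]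
  exact fun e he => mem_powersetCard.2 ⟨subset_univ _, hG e he⟩

theorem isRankBounded_iff {n t r s : ℕ} {G : Finset (Finset (Fin n))} :
    IsRankBounded n t r s G ↔ IsRGraph r G ∧ inclusionRank s G + t ≤ n.choose s := by
  unfold IsRankBounded
  refine and_congr_right fun _ => ?_
  omega

end RankExtremal

/-! ### The main theorem -/

open Finset in
theorem theorem5 (r s : ℕ) (hs : 1 ≤ s) (hrs : s < r) :
    ∃ c₀ : ℝ, ∃ n₀ : ℕ, 0 < c₀ ∧ 0 < n₀ ∧
      ∀ n t : ℕ, n₀ ≤ n → 1 ≤ t → (t : ℝ) ≤ c₀ * (n : ℝ) →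
        (RankExtremal.rex n t r s : ℤ)
            = (n.choose r : ℤ) - ((n - s + 1).choose (r - s + 1) : ℤ)
                + ((n - s + 1 - t).choose (r - s + 1) : ℤ) ∧
        (∃ S : Finset (Finset (Fin n)), RankExtremal.IsStarConfiguration s S ∧ S.card = t) ∧
        (∀ S : Finset (Finset (Fin n)), RankExtremal.IsStarConfiguration s S → S.card = t →
          ∀ G : Finset (Finset (Fin n)),
            RankExtremal.IsRankExtremal n t r s G ↔
              RankExtremal.IsIsomorphic (RankExtremal.completeMinusUpShadow r s S) G) := by
  have hC := RankExtremal.four_le_thresholdConstant hrs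
  have hC0 : (0 : ℝ) < RankExtremal.thresholdConstant r s := by
    exact_mod_cast (by omega : 0 < RankExtremal.thresholdConstant r s)
  refine ⟨1 / RankExtremal.thresholdConstant r s, 4 * r, by positivity, by omega, ?_⟩
  intro n t hn ht1 ht
  have htn : RankExtremal.thresholdConstant r s * t ≤ n := by
    rw [one_div_mul_eq_div, le_div_iff₀ hC0] at ht
    rw [mul_comm]
    exact_mod_cast ht
  -- Ensures that a star of size t fits into n vertices.
  have ht4 : 4 * t ≤ n := (Nat.mul_le_mul_right _ hC).trans htn
  set g := ∑ i ∈ range t, (n - s - i).choose (r - s) with hg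
  have core : ∀ G : Finset (Finset (Fin n)), RankExtremal.IsRankBounded n t r s G →
      (powersetCard r univ \ G).card ≤ g → ∃ F, RankExtremal.IsStarConfiguration s F ∧
        F.card = t ∧ powersetCard r univ \ G = RankExtremal.upFamily r F := by
    intro G hG hle
    rw [RankExtremal.isRankBounded_iff] at hG
    refine RankExtremal.exists_isStarConfiguration_of_card_le hs hrs (by simpa using hn) ht1
      (by simpa using htn) (by simpa using hG.2) (by simpa using hle)
  have hup : ∀ F : Finset (Finset (Fin n)), RankExtremal.IsStarConfiguration s F → F.card = t →
      (RankExtremal.upFamily r F).card = g := by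
    intro F hF hFt
    have := RankExtremal.card_upFamily_eq_sum hs hrs.le hF (by rw [Fintype.card_fin]; omega)
    rwa [Fintype.card_fin, hFt] at this
  have hlow : ∀ G : Finset (Finset (Fin n)), RankExtremal.IsRankBounded n t r s G →
      G.card + g ≤ n.choose r := by
    intro G hG
    have h1 := RankExtremal.card_add_card_complement hG.1
    rw [Fintype.card_fin] at h1
    -- With more edges, `core` would make the complement a star shadow, whose size is exactly g.
    by_contra hcon
    obtain ⟨F, hF, hFt, hGF⟩ := core G hG (by omega)
    rw [hGF, hup F hF hFt] at h1
    omega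
  have hstar : ∀ F : Finset (Finset (Fin n)), RankExtremal.IsStarConfiguration s F → F.card = t →
      RankExtremal.IsRankBounded n t r s (powersetCard r univ \ RankExtremal.upFamily r F) ∧
      (powersetCard r univ \ RankExtremal.upFamily r F).card + g = n.choose r := by
    intro F hF hFt
    refine ⟨RankExtremal.isRankBounded_iff.2 ⟨fun e he =>
      (mem_powersetCard.1 (mem_sdiff.1 he).1).2, ?_⟩, ?_⟩
    · have := RankExtremal.inclusionRank_complement_upFamily_add_le (r := r) hF.1
      rwa [Fintype.card_fin, hFt] at this
    · have h1 := card_sdiff_add_card_eq_card (show RankExtremal.upFamily r F ⊆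
        powersetCard r univ from filter_subset _ _)
      rwa [hup F hF hFt, card_powersetCard, card_univ, Fintype.card_fin] at h1
  obtain ⟨F₀, hF₀, hF₀t⟩ := RankExtremal.exists_isStarConfiguration (V := Fin n) (t := t) hs
    (by rw [Fintype.card_fin]; omega)
  have hrex : RankExtremal.rex n t r s + g = n.choose r := by
    have h0 := hstar F₀ hF₀ hF₀t
    rw [← h0.2]
    congr 1
    refine IsGreatest.csSup_eq ⟨⟨_, h0.1, rfl⟩, ?_⟩
    rintro m ⟨G, hG, rfl⟩
    have := hlow G hG
    omega
  refine ⟨?_, ⟨F₀, hF₀, hF₀t⟩, ?_⟩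
  · have := RankExtremal.sum_choose_sub (n - s) (r - s) t (by omega)
    omega
  · intro S hS hSt G
    rw [RankExtremal.completeMinusUpShadow_eq hrs.le hS.1]
    constructor
    · rintro ⟨hG, hGc⟩
      have h1 := RankExtremal.card_add_card_complement hG.1
      rw [Fintype.card_fin] at h1
      obtain ⟨F, hF, hFt, hGF⟩ := core G hG (by omega)
      obtain ⟨σ, hσ⟩ := hS.exists_perm hs hF (hSt.trans hFt.symm)
      refine ⟨σ, ?_⟩
      rw [RankExtremal.image_complement_upFamily, hσ, ← hGF, Finset.sdiff_sdiff_eq_self]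
      exact fun e he => mem_powersetCard.2 ⟨subset_univ _, hG.1 e he⟩
    · rintro ⟨σ, rfl⟩
      rw [RankExtremal.image_complement_upFamily]
      obtain ⟨hσ, hσt⟩ := hS.image_perm hs σ
      have := hstar _ hσ (hσt.trans hSt)
      exact ⟨this.1, by omega⟩
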